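/- A random rooted, locally finite tree $\mathsf T$ with root $o$ is called conditionally independent, with average offspring numbers bounded by $\Delta<\infty$, if for each integer $k\ge 0$, conditionally on the subtree $\mathsf T(k)$ of the first $k$ generations (generations $0,\dots,k$), the offspring numbers $\Delta_j$ of the vertices $j$ at generation $k$ are independent of each other, each with conditional mean at most $\Delta$. (The tree is not truncated at any generation; vertices may have no offspring.) Write $\partial\mathsf T(\ell)$ for the set of vertices at generation $\ell$ and $\mathsf T(-1)=\emptyset$. For $\beta\ge0$ and real magnetic fields $(B_i)$ let $\mu^{\ell,0}$ be the Ising measure on $\{+1,-1\}^{\mathsf T(\ell)}$ with free boundary condition, $$\mu^{\ell,0}(x)\ \propto\ \exp\Big\{\beta\sum_{(ij)\in\mathsf T(\ell)}x_ix_j+\sum_{i\in\mathsf T(\ell)}B_ix_i\Big\},$$ where the first sum is over the edges of $\mathsf T(\ell)$, and let $\mu^{\ell,+}$ be the one with plus boundary condition, that is, $\mu^{\ell,0}$ conditioned on $x_i=+1$ for all $i\in\partial\mathsf T(\ell)$. Let $\mu_U$ denote the marginal of $\mu$ on $\{+1,-1\}^U$, and let $\|p-q\|_{\mathrm{TV}}=\frac12\sum_x|p(x)-q(x)|$.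 Theorem. For $0<B_{\min}\le B_{\max}$, $\beta_{\max}$ and $\Delta$ finite there exist finite constants $M=M(\beta_{\max},B_{\min},\Delta)$ and $C=C(\beta_{\max},B_{\max})$ such that the following holds. Let $\mathsf T$ be a conditionally independent tree with average offspring numbers bounded by $\Delta$, let $0\le r<\ell$ be integers, and let the fields (which may be random and may depend on $\mathsf T$) satisfy, almost surely, $B_i\le B_{\max}$ for all $i\in\mathsf T(r-1)$ and $B_i\ge B_{\min}$ for all $i\in\mathsf T(\ell)$. Then, for every (possibly random) $U\subseteq\mathsf T(r)$ and every $0\le\beta\le\beta_{\max}$, $$\mathbb E\,\big\|\mu_U^{\ell,+}-\mu_U^{\ell,0}\big\|_{\mathrm{TV}}\ \le\ \frac{M}{\ell-r}\;\mathbb E\big\{C^{|\mathsf T(r)|}\big\},$$ where the right-hand side may be infinite. -/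

import Mathlib

open MeasureTheory ProbabilityTheory
open scoped NNReal ENNReal

namespace IsingTree

/-- Vertices of a locally finite rooted tree, in Ulam-Harris notation: the root is `[]`, and the
children of `v` are `0 :: v, 1 :: v, …, (N v - 1) :: v`, where `N v` is the offspring number of `v`.
The generation of `v` is `v.length`. -/
abbrev Vertex : Type := List ℕ

/-- The set of vertices at generation exactly `k` of the tree with offspring numbers `N`. The values
of `N` at labels that are not vertices of the tree play no role. -/
def sphere (N : Vertex → ℕ) : ℕ → Finset Vertex
  | 0 => {[]}
  | k + 1 => (sphere N k).biUnion fun v => (Finset.range (N v)).image fun n => n :: v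

/-- The vertex set of the subtree of the first `k` generations. Since labels record ancestry, this
set determines the subtree. -/
def ball (N : Vertex → ℕ) (k : ℕ) : Finset Vertex :=
  (Finset.range (k + 1)).biUnion (sphere N)

/-- `u` is the parent of `v`. -/
def IsParent (u v : Vertex) : Prop := v ≠ [] ∧ v.tail = u

instance (u v : Vertex) : Decidable (IsParent u v) := by
  unfold IsParent; infer_instance

/-- The random tree with offspring numbers `N` is conditionally independent, with conditional mean
offspring numbers bounded by `Δ`: for every `k`, conditionally on the subtree of the first `k`
generations, the offspring numbers of the vertices at generation `k` are independent of each other,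
and each has mean at most `Δ`. The subtree takes countably many values, so this is conditioning on
the events of positive probability that it equals a given `t`. -/
structure IsCondIndepTree {Ω : Type*} [MeasurableSpace Ω] (P : Measure Ω)
    (N : Ω → Vertex → ℕ) (Δ : ℝ≥0) : Prop where
  measurable_offspring : ∀ v, Measurable fun ω => N ω v
  indep : ∀ (k : ℕ) (t : Finset Vertex), P {ω | ball (N ω) k = t} ≠ 0 →
    iIndepFun (fun (j : {v : Vertex // v ∈ t ∧ v.length = k}) (ω : Ω) => N ω j)
      (P[|{ω | ball (N ω) k = t}])
  mean_le : ∀ (k : ℕ) (t : Finset Vertex), P {ω | ball (N ω) k = t} ≠ 0 →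
    ∀ j ∈ t, j.length = k →
      ∫⁻ ω, (N ω j : ℝ≥0∞) ∂(P[|{ω | ball (N ω) k = t}]) ≤ (Δ : ℝ≥0∞)

/-- The real value `±1` of a spin. -/
def spin (s : ℤˣ) : ℝ := ((s : ℤ) : ℝ)

/-- Boltzmann weight `exp (β ∑_{edges (i, j)} x_i x_j + ∑_i B_i x_i)` of a spin configuration on the
vertex set `V`; each edge is counted once, from parent to child. -/
noncomputable def weight (β : ℝ) (B : Vertex → ℝ) (V : Finset Vertex) (x : V → ℤˣ) : ℝ :=
  Real.exp (β * (∑ i : V, ∑ j : V, if IsParent (i : Vertex) (j : Vertex) then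
      spin (x i) * spin (x j) else 0) + ∑ i : V, B i * spin (x i))

/-- Probability mass function of the Ising measure with free boundary condition on the subtree of
the first `ℓ` generations. -/
noncomputable def isingFree (N : Vertex → ℕ) (β : ℝ) (B : Vertex → ℝ) (ℓ : ℕ)
    (x : ball N ℓ → ℤˣ) : ℝ :=
  weight β B (ball N ℓ) x / ∑ z, weight β B (ball N ℓ) z

/-- Boltzmann weight restricted to the configurations that are `+1` at all vertices of
generation `ℓ`. -/
noncomputable def plusWeight (N : Vertex → ℕ) (β : ℝ) (B : Vertex → ℝ) (ℓ : ℕ)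
    (x : ball N ℓ → ℤˣ) : ℝ :=
  if ∀ i : ball N ℓ, (i : Vertex).length = ℓ → x i = 1 then weight β B (ball N ℓ) x else 0

/-- Probability mass function of the Ising measure with plus boundary condition on the subtree of
the first `ℓ` generations. -/
noncomputable def isingPlus (N : Vertex → ℕ) (β : ℝ) (B : Vertex → ℝ) (ℓ : ℕ)
    (x : ball N ℓ → ℤˣ) : ℝ :=
  plusWeight N β B ℓ x / ∑ z, plusWeight N β B ℓ z

/-- Marginal on `U ⊆ V` of a mass function on spin configurations on `V`. -/
def marginal {V : Finset Vertex} (U : Finset Vertex) (μ : (V → ℤˣ) → ℝ) (y : U → ℤˣ) : ℝ :=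
  ∑ x : V → ℤˣ, if ∀ (i : V) (hi : (i : Vertex) ∈ U), x i = y ⟨i, hi⟩ then μ x else 0

/-- Total variation distance of two mass functions on a finite set. -/
noncomputable def tvDist {α : Type*} [Fintype α] (p q : α → ℝ) : ℝ :=
  (1 / 2) * ∑ a, |p a - q a|

end IsingTree

/-!
The bound holds realization by realization: on every locally finite tree the total variation
distance is at most `K / (ℓ - r) * C ^ |T(r)|`, with `K` depending on `βmax` and `Bmin` only
(`tvDist_plus_free_le`). The theorem follows by integration.

*Reduction to magnetizations.* Summing out the spins generation by generation
(`marginal_leafWeight_succ`) shows that the marginals of both measures on the first `r` generations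
are Ising measures in which a vertex `v` of generation `r` has an a priori magnetization
`tanh (h v)`. The effective field `h v` satisfies the recursion
`h v = B v + ∑ message β (h child)`, where `message β h = artanh (tanh β * tanh h)`. The free
boundary condition starts it at generation `ℓ` from the fields `B`; the plus boundary condition
starts it at generation `ℓ - 1` from the fields `B v + N v * β`. The Boltzmann factor of the other
fields and of the edges lies between `exp (±(β + Bmax) * |T(r)|)`, and the factors
`1 ± tanh (h v)` are Lipschitz in the magnetizations; this gives the factor `C ^ |T(r)|`
(`tvDist_leafWeight_le`).

*Decay of the magnetization gap.* The maps `message β` and `tanh` are increasing and concave on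
`[0, ∞)`, so the magnetization is an increasing concave function of the boundary fields. Compare the
free boundary condition at depth `k`, the free one at depth `k + 1`, and the plus one at depth
`k + 1`: seen from depth `k`, each boundary field gains nothing, a sum of terms `message β (B child)`,
and a sum of as many terms `β`, respectively. Since `β ≤ K * message β Bmin`, concavity yields
`plus (k + 1) - free k ≤ K * (free (k + 1) - free k)`. The left side is at least the gap between plus
and free at the final depth, because plus decreases and free increases with the depth; the right side
telescopes when summed over `k`, to at most `K` (`magnetization_gap_le`).
-/

namespace IsingTree

/-! ### The one-edge message map -/

/-- The field `artanh (tanh β * tanh h)` that a vertex with effective field `h` exerts on its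
parent, written in a form symmetric in `β` and `h`. -/
noncomputable def message (β h : ℝ) : ℝ :=
  (Real.log (Real.cosh (h + β)) - Real.log (Real.cosh (h - β))) / 2

theorem message_comm (β h : ℝ) : message β h = message h β := by
  unfold message
  rw [add_comm h β, ← Real.cosh_neg (h - β), neg_sub]

@[simp] theorem message_zero_left (h : ℝ) : message 0 h = 0 := by simp [message]

@[simp] theorem message_zero_right (β : ℝ) : message β 0 = 0 := by simp [message]

theorem hasDerivAt_message (β h : ℝ) :
    HasDerivAt (message β)
      (Real.sinh (2 * β) / (2 * (Real.cosh (h + β) * Real.cosh (h - β)))) h := by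
  have h1 : HasDerivAt (fun x => Real.log (Real.cosh (x + β)))
      (Real.sinh (h + β) * 1 / Real.cosh (h + β)) h :=
    (((hasDerivAt_id h).add_const β).cosh).log (Real.cosh_pos _).ne'
  have h2 : HasDerivAt (fun x => Real.log (Real.cosh (x - β)))
      (Real.sinh (h - β) * 1 / Real.cosh (h - β)) h :=
    (((hasDerivAt_id h).sub_const β).cosh).log (Real.cosh_pos _).ne'
  refine ((h1.sub h2).div_const 2).congr_deriv ?_
  have e : 2 * β = (h + β) - (h - β) := by ring
  have p1 := (Real.cosh_pos (h + β)).ne'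
  have p2 := (Real.cosh_pos (h - β)).ne'
  rw [e, Real.sinh_sub (h + β)]
  field_simp

theorem cosh_add_mul_cosh_sub (h β : ℝ) :
    Real.cosh (h + β) * Real.cosh (h - β) = Real.cosh h ^ 2 + Real.sinh β ^ 2 := by
  rw [Real.cosh_add, Real.cosh_sub]
  have h1 := Real.cosh_sq h
  have h2 := Real.cosh_sq β
  linear_combination Real.sinh β ^ 2 * h1 + Real.cosh h ^ 2 * h2

theorem message_monotone {β : ℝ} (hβ : 0 ≤ β) : Monotone (message β) := by
  refine monotone_of_hasDerivAt_nonneg (fun h => hasDerivAt_message β h) fun h => ?_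
  have := Real.sinh_nonneg_iff.2 (show 0 ≤ 2 * β by linarith)
  have p1 := (Real.cosh_pos (h + β))
  have p2 := (Real.cosh_pos (h - β))
  positivity

theorem message_concaveOn {β : ℝ} (hβ : 0 ≤ β) : ConcaveOn ℝ (Set.Ici 0) (message β) := by
  refine AntitoneOn.concaveOn_of_deriv (convex_Ici 0)
    (fun h _ => (hasDerivAt_message β h).continuousAt.continuousWithinAt)
    (fun h _ => (hasDerivAt_message β h).differentiableAt.differentiableWithinAt) ?_
  intro x hx y hy hxy
  rw [interior_Ici, Set.mem_Ioi] at hx hy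
  rw [(hasDerivAt_message β x).deriv, (hasDerivAt_message β y).deriv,
    cosh_add_mul_cosh_sub, cosh_add_mul_cosh_sub]
  have := Real.sinh_nonneg_iff.2 (show 0 ≤ 2 * β by linarith)
  have hc : Real.cosh x ≤ Real.cosh y := by
    rwa [Real.cosh_le_cosh, abs_of_pos hx, abs_of_pos hy]
  have := Real.cosh_pos x
  gcongr

theorem message_nonneg {β h : ℝ} (hβ : 0 ≤ β) (hh : 0 ≤ h) : 0 ≤ message β h := by
  simpa using message_monotone hβ hh

theorem message_pos {β h : ℝ} (hβ : 0 < β) (hh : 0 < h) : 0 < message β h := by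
  unfold message
  have : Real.cosh (h - β) < Real.cosh (h + β) := by
    rw [Real.cosh_lt_cosh, abs_lt, abs_of_pos (by linarith)]
    constructor <;> linarith
  have := Real.log_lt_log (Real.cosh_pos _) this
  linarith

theorem message_le {β : ℝ} (hβ : 0 ≤ β) (h : ℝ) : message β h ≤ β := by
  unfold message
  have h1 : Real.cosh (h + β) ≤ Real.exp (2 * β) * Real.cosh (h - β) := by
    rw [Real.cosh_eq, Real.cosh_eq]
    have e1 : Real.exp (2 * β) * ((Real.exp (h - β) + Real.exp (-(h - β))) / 2)
        = (Real.exp (h + β) + Real.exp (-h + 3 * β)) / 2 := by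
      rw [mul_div_assoc', mul_add, ← Real.exp_add, ← Real.exp_add]
      ring_nf
    rw [e1]
    have : Real.exp (-(h + β)) ≤ Real.exp (-h + 3 * β) := Real.exp_le_exp.2 (by linarith)
    linarith
  have h2 := Real.log_le_log (Real.cosh_pos _) h1
  rw [Real.log_mul (Real.exp_pos _).ne' (Real.cosh_pos _).ne', Real.log_exp] at h2
  linarith

/-- A concave function does not increase the ratio of a long increment to a short one with the same
left end point. -/
theorem concaveOn_sub_le_mul_sub {f : ℝ → ℝ} {s : Set ℝ} (hf : ConcaveOn ℝ s f)
    {x₀ x₁ x₂ K : ℝ} (h₀ : x₀ ∈ s) (h₂ : x₂ ∈ s) (h₀₁ : x₀ ≤ x₁) (h₁₂ : x₁ ≤ x₂)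
    (hf₀₂ : f x₀ ≤ f x₂) (hK : x₂ - x₀ ≤ K * (x₁ - x₀)) :
    f x₂ - f x₀ ≤ K * (f x₁ - f x₀) := by
  rcases eq_or_lt_of_le (h₀₁.trans h₁₂) with h | h
  · obtain rfl : x₁ = x₀ := le_antisymm (h ▸ h₁₂) h₀₁
    simp [h]
  have hpos : 0 < x₂ - x₀ := sub_pos.2 h
  have h01 : 0 < x₁ - x₀ := by
    rcases eq_or_lt_of_le h₀₁ with h' | h'
    · subst h'
      simp at hK
      linarith
    · linarith
  have hK0 : 0 ≤ K := by
    by_contra hneg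
    nlinarith
  have key : (x₁ - x₀) * (f x₂ - f x₀) ≤ (x₂ - x₀) * (f x₁ - f x₀) := by
    have := hf.2 h₀ h₂ (show 0 ≤ (x₂ - x₁) / (x₂ - x₀) by apply div_nonneg <;> linarith)
      (show 0 ≤ (x₁ - x₀) / (x₂ - x₀) by positivity) (by field_simp; ring)
    simp only [smul_eq_mul] at this
    have e : (x₂ - x₁) / (x₂ - x₀) * x₀ + (x₁ - x₀) / (x₂ - x₀) * x₂ = x₁ := by
      field_simp; ring
    rw [e] at this
    have h3 := mul_le_mul_of_nonneg_left this hpos.le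
    have e2 : (x₂ - x₀) * ((x₂ - x₁) / (x₂ - x₀) * f x₀ + (x₁ - x₀) / (x₂ - x₀) * f x₂)
      = (x₂ - x₁) * f x₀ + (x₁ - x₀) * f x₂ := by field_simp
    rw [e2] at h3
    linarith
  have h4 : (x₂ - x₀) * (f x₂ - f x₀) ≤ (x₂ - x₀) * (K * (f x₁ - f x₀)) := by
    have a := mul_le_mul_of_nonneg_right hK (sub_nonneg.2 hf₀₂)
    have b := mul_le_mul_of_nonneg_left key hK0
    linarith
  exact le_of_mul_le_mul_left h4 hpos

/-- The ratio of the field `βmax` exerted by a child with spin `+1` to the field exerted by a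
child with effective field `b`, at inverse temperature `βmax`; it is `0` for `βmax = 0`. -/
noncomputable def messageRatio (βmax b : ℝ) : ℝ := βmax / message βmax b

/-- By symmetry `message β b` is concave in `β`, so the ratio to `β` is smallest at `βmax`. -/
theorem le_messageRatio_mul {β βmax b : ℝ} (hβ : 0 ≤ β) (hβm : β ≤ βmax) (hb : 0 < b) :
    β ≤ messageRatio βmax b * message β b := by
  rcases eq_or_lt_of_le hβ with rfl | hpos
  · simp
  have hm := hpos.trans_le hβm
  have hu := message_pos hm hb
  have := (message_concaveOn hb.le).2 (Set.mem_Ici.2 le_rfl) (Set.mem_Ici.2 hm.le)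
    (show 0 ≤ 1 - β / βmax by rw [sub_nonneg, div_le_one hm]; exact hβm)
    (show 0 ≤ β / βmax by positivity) (by ring)
  simp only [smul_eq_mul, message_zero_right, mul_zero, zero_add] at this
  rw [div_mul_cancel₀ _ hm.ne', message_comm b, message_comm b] at this
  unfold messageRatio
  rw [div_mul_eq_mul_div, le_div_iff₀ hu]
  rw [div_mul_eq_mul_div, div_le_iff₀ hm] at this
  linarith

theorem hasDerivAt_tanh (x : ℝ) : HasDerivAt Real.tanh (1 / Real.cosh x ^ 2) x := by
  have h := (Real.hasDerivAt_sinh x).div (Real.hasDerivAt_cosh x) (Real.cosh_pos x).ne'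
  have e : Real.tanh = fun y => Real.sinh y / Real.cosh y := by
    ext y; exact Real.tanh_eq_sinh_div_cosh y
  rw [e]
  refine h.congr_deriv ?_
  have := Real.cosh_sq x
  congr 1
  linarith

theorem tanh_monotone : Monotone Real.tanh :=
  monotone_of_hasDerivAt_nonneg hasDerivAt_tanh fun x => by
    have := Real.cosh_pos x
    positivity

theorem tanh_concaveOn : ConcaveOn ℝ (Set.Ici 0) Real.tanh := by
  refine AntitoneOn.concaveOn_of_deriv (convex_Ici 0)
    (fun h _ => (hasDerivAt_tanh h).continuousAt.continuousWithinAt)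
    (fun h _ => (hasDerivAt_tanh h).differentiableAt.differentiableWithinAt) ?_
  intro x hx y hy hxy
  rw [interior_Ici, Set.mem_Ioi] at hx hy
  rw [(hasDerivAt_tanh x).deriv, (hasDerivAt_tanh y).deriv]
  have hc : Real.cosh x ≤ Real.cosh y := by
    rwa [Real.cosh_le_cosh, abs_of_pos hx, abs_of_pos hy]
  have := Real.cosh_pos x
  gcongr

theorem tanh_nonneg {x : ℝ} (hx : 0 ≤ x) : 0 ≤ Real.tanh x := by
  simpa using tanh_monotone hx

theorem tanh_le_one (x : ℝ) : Real.tanh x ≤ 1 := (Real.tanh_lt_one x).le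

/-! ### Propagation of effective fields towards the root -/

/-- One step of the effective field recursion: the field at `v` when its children have effective
fields `h`. -/
noncomputable def fieldStep (N : Vertex → ℕ) (β : ℝ) (B h : Vertex → ℝ) (v : Vertex) : ℝ :=
  B v + ∑ i ∈ Finset.range (N v), message β (h (i :: v))

section Recursion

variable {N : Vertex → ℕ} {β : ℝ} {B : Vertex → ℝ}

theorem fieldStep_monotone (hβ : 0 ≤ β) : Monotone (fieldStep N β B) := by
  intro h h' hh v
  unfold fieldStep
  gcongr with i _
  exact message_monotone hβ (hh _)

theorem iterate_fieldStep_nonneg (hβ : 0 ≤ β) (hB : 0 ≤ B) {h : Vertex → ℝ} (hh : 0 ≤ h) (n : ℕ) :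
    0 ≤ (fieldStep N β B)^[n] h := by
  induction n with
  | zero => exact hh
  | succ n ih =>
    rw [Function.iterate_succ_apply']
    intro v
    exact add_nonneg (hB v) (Finset.sum_nonneg fun i _ => message_nonneg hβ (ih _))

/-- Comparison of the increments of the recursion started from three ordered families of fields;
this is the concavity of the effective field in the boundary fields. -/
theorem iterate_fieldStep_sub_le (hβ : 0 ≤ β) (hB : 0 ≤ B) {h₀ h₁ h₂ : Vertex → ℝ} {K : ℝ}
    (h0 : 0 ≤ h₀) (h01 : h₀ ≤ h₁) (h12 : h₁ ≤ h₂)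
    (hK : ∀ v, h₂ v - h₀ v ≤ K * (h₁ v - h₀ v)) (n : ℕ) (v : Vertex) :
    (fieldStep N β B)^[n] h₂ v - (fieldStep N β B)^[n] h₀ v ≤
      K * ((fieldStep N β B)^[n] h₁ v - (fieldStep N β B)^[n] h₀ v) := by
  induction n generalizing v with
  | zero => exact hK v
  | succ n ih =>
    simp only [Function.iterate_succ_apply']
    have p0 := iterate_fieldStep_nonneg (N := N) hβ hB h0 n
    have p2 := iterate_fieldStep_nonneg (N := N) hβ hB (h0.trans (h01.trans h12)) n
    have m01 := (fieldStep_monotone (N := N) (B := B) hβ).iterate n h01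
    have m12 := (fieldStep_monotone (N := N) (B := B) hβ).iterate n h12
    simp only [fieldStep, add_sub_add_left_eq_sub, ← Finset.sum_sub_distrib, Finset.mul_sum]
    exact Finset.sum_le_sum fun i _ => concaveOn_sub_le_mul_sub (message_concaveOn hβ) (p0 _) (p2 _)
      (m01 _) (m12 _) (message_monotone hβ ((m01 _).trans (m12 _))) (ih _)

/-- The effective fields of the generation above a generation of spins fixed to `+1`. -/
def plusField (N : Vertex → ℕ) (β : ℝ) (B : Vertex → ℝ) (v : Vertex) : ℝ := B v + N v * β

theorem le_fieldStep (hβ : 0 ≤ β) {h : Vertex → ℝ} (hh : 0 ≤ h) : B ≤ fieldStep N β B h :=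
  fun _ => le_add_of_nonneg_right (Finset.sum_nonneg fun _ _ => message_nonneg hβ (hh _))

theorem fieldStep_le_plusField (hβ : 0 ≤ β) (h : Vertex → ℝ) :
    fieldStep N β B h ≤ plusField N β B := by
  intro v
  unfold fieldStep plusField
  gcongr
  refine (Finset.sum_le_sum fun i _ => message_le hβ _).trans ?_
  simp

/-- The root magnetizations of the plus and of the free boundary condition at distance `n + 1`
differ by `O(1 / (n + 1))`. The increments of the free magnetization in the distance sum to at most
one, each controls the gap between plus and free at its distance, and this gap decreases. -/
theorem magnetization_gap_le {βmax b : ℝ} (hβ : 0 ≤ β) (hβm : β ≤ βmax) (hb : 0 < b)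
    (hB : ∀ v, b ≤ B v) (n : ℕ) (v : Vertex) :
    ((n + 1 : ℕ) : ℝ) * (Real.tanh ((fieldStep N β B)^[n] (plusField N β B) v) -
      Real.tanh ((fieldStep N β B)^[n + 1] B v)) ≤ messageRatio βmax b := by
  set T := fieldStep N β B with hT
  have hB0 : 0 ≤ B := fun v => hb.le.trans (hB v)
  have hTm : Monotone T := fieldStep_monotone hβ
  have hfree : Monotone fun k => T^[k] B :=
    hTm.monotone_iterate_of_le_map (le_fieldStep hβ hB0)
  have hplus : Antitone fun k => T^[k] (plusField N β B) :=
    hTm.antitone_iterate_of_map_le (fieldStep_le_plusField hβ _)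
  have hp : ∀ k, T^[k + 1] B ≤ T^[k] (plusField N β B) := fun k => by
    rw [Function.iterate_succ_apply]
    exact hTm.iterate k (fieldStep_le_plusField hβ _)
  have hK0 : 0 ≤ messageRatio βmax b :=
    div_nonneg (hβ.trans hβm) (message_nonneg (hβ.trans hβm) hb.le)
  have hbase : ∀ w, plusField N β B w - B w ≤ messageRatio βmax b * (T B w - B w) := by
    intro w
    simp only [hT, plusField, fieldStep, add_sub_cancel_left, Finset.mul_sum]
    have : ((N w : ℕ) : ℝ) * β = ∑ _i ∈ Finset.range (N w), β := by simp
    rw [this]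
    refine Finset.sum_le_sum fun i _ => (le_messageRatio_mul hβ hβm hb).trans ?_
    gcongr
    exact message_monotone hβ (hB _)
  have hstep : ∀ k, Real.tanh (T^[k] (plusField N β B) v) - Real.tanh (T^[k] B v) ≤
      messageRatio βmax b * (Real.tanh (T^[k + 1] B v) - Real.tanh (T^[k] B v)) := by
    intro k
    have p0 := iterate_fieldStep_nonneg (N := N) hβ hB0 hB0 k v
    have m01 := hfree (Nat.le_succ k) v
    have m12 := hp k v
    refine concaveOn_sub_le_mul_sub tanh_concaveOn p0 ((p0.trans m01).trans m12) m01 m12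
      (tanh_monotone (m01.trans m12)) ?_
    rw [Function.iterate_succ_apply]
    exact iterate_fieldStep_sub_le hβ hB0 hB0 (le_fieldStep hβ hB0)
      (fieldStep_le_plusField hβ _) hbase k v
  have hgap : ∀ k ∈ Finset.range (n + 1),
      Real.tanh (T^[n] (plusField N β B) v) - Real.tanh (T^[n + 1] B v) ≤
      messageRatio βmax b * (Real.tanh (T^[k + 1] B v) - Real.tanh (T^[k] B v)) := by
    intro k hk
    rw [Finset.mem_range] at hk
    have a1 := tanh_monotone (hplus (show k ≤ n by omega) v)
    have a2 := tanh_monotone (hfree (show k ≤ n + 1 by omega) v)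
    have := hstep k
    simp only at a1 a2
    linarith
  have hsum := Finset.sum_le_sum hgap
  rw [← Finset.mul_sum, Finset.sum_range_sub (fun k => Real.tanh (T^[k] B v))] at hsum
  simp only [Finset.sum_const, Finset.card_range, nsmul_eq_mul] at hsum
  refine hsum.trans (mul_le_of_le_one_right hK0 ?_)
  have := tanh_le_one (T^[n + 1] B v)
  have := tanh_nonneg (hB0 v)
  simp only [Function.iterate_zero, id] at *
  linarith

theorem magnetization_free_le_plus (hβ : 0 ≤ β) (n : ℕ) (v : Vertex) :
    Real.tanh ((fieldStep N β B)^[n + 1] B v) ≤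
      Real.tanh ((fieldStep N β B)^[n] (plusField N β B) v) := by
  refine tanh_monotone ?_
  rw [Function.iterate_succ_apply]
  exact (fieldStep_monotone hβ).iterate n (fieldStep_le_plusField hβ _) v

end Recursion

/-! ### Generations of the tree -/

section Tree

variable {N : Vertex → ℕ}

theorem length_of_mem_sphere {k : ℕ} {v : Vertex} (h : v ∈ sphere N k) : v.length = k := by
  induction k generalizing v with
  | zero => simpa [sphere] using h
  | succ k ih =>
    simp only [sphere, Finset.mem_biUnion, Finset.mem_image] at h
    obtain ⟨u, hu, i, -, rfl⟩ := h
    simp [ih hu]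

theorem cons_mem_sphere {k i : ℕ} {v : Vertex} :
    i :: v ∈ sphere N (k + 1) ↔ v ∈ sphere N k ∧ i < N v := by
  simp [sphere]

theorem tail_mem_sphere {k : ℕ} {w : Vertex} (h : w ∈ sphere N (k + 1)) :
    w.tail ∈ sphere N k := by
  cases w with
  | nil => simpa using length_of_mem_sphere h
  | cons i v => exact (cons_mem_sphere.1 h).1

theorem mem_ball {k : ℕ} {v : Vertex} : v ∈ ball N k ↔ ∃ j ≤ k, v ∈ sphere N j := by
  simp [ball]

theorem sphere_subset_ball {j k : ℕ} (h : j ≤ k) : sphere N j ⊆ ball N k :=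
  fun _ hv => mem_ball.2 ⟨j, h, hv⟩

theorem ball_mono {j k : ℕ} (h : j ≤ k) : ball N j ⊆ ball N k := fun _ hv => by
  obtain ⟨i, hi, hv⟩ := mem_ball.1 hv
  exact mem_ball.2 ⟨i, hi.trans h, hv⟩

theorem length_le_of_mem_ball {k : ℕ} {v : Vertex} (h : v ∈ ball N k) : v.length ≤ k := by
  obtain ⟨j, hj, hv⟩ := mem_ball.1 h
  rwa [length_of_mem_sphere hv]

theorem ball_zero : ball N 0 = {[]} := by simp [ball, sphere]

theorem disjoint_ball_sphere (k : ℕ) : Disjoint (ball N k) (sphere N (k + 1)) :=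
  Finset.disjoint_left.2 fun v h h' => by
    have := length_le_of_mem_ball h
    rw [length_of_mem_sphere h'] at this
    omega

theorem ball_succ (k : ℕ) : ball N (k + 1) = (ball N k).disjUnion (sphere N (k + 1))
    (disjoint_ball_sphere k) := by
  ext v
  simp only [mem_ball, Finset.mem_disjUnion]
  constructor
  · rintro ⟨j, hj, hv⟩
    rcases Nat.lt_or_ge k j with h | h
    · obtain rfl : j = k + 1 := by omega
      exact Or.inr hv
    · exact Or.inl ⟨j, h, hv⟩
  · rintro (⟨j, hj, hv⟩ | hv)
    · exact ⟨j, by omega, hv⟩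
    · exact ⟨_, le_rfl, hv⟩

theorem prod_sphere_succ (k : ℕ) (f : Vertex → ℝ) :
    ∏ w ∈ sphere N (k + 1), f w = ∏ v ∈ sphere N k, ∏ i ∈ Finset.range (N v), f (i :: v) := by
  rw [sphere, Finset.prod_biUnion]
  · refine Finset.prod_congr rfl fun v _ => Finset.prod_image ?_
    intro i _ j _ h
    simpa using h
  · intro u _ v _ huv
    simp only [Function.onFun, Finset.disjoint_left, Finset.mem_image]
    rintro _ ⟨i, -, rfl⟩ ⟨j, -, h⟩
    exact huv (List.cons.inj h).2.symm

end Tree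

/-! ### Spins -/

theorem spin_one : spin 1 = 1 := by simp [spin]

theorem spin_neg_one : spin (-1) = -1 := by simp [spin]

theorem sum_spin (f : ℤˣ → ℝ) : ∑ s, f s = f 1 + f (-1) := by
  rw [UnitsInt.univ, Finset.sum_pair (by decide)]

theorem abs_spin (s : ℤˣ) : |spin s| = 1 := by
  rcases Int.units_eq_one_or s with rfl | rfl <;> simp [spin_one, spin_neg_one]

theorem exp_spin_mul (s : ℤˣ) (h : ℝ) :
    Real.exp (spin s * h) = Real.cosh h * (1 + spin s * Real.tanh h) := by
  have := (Real.cosh_pos h).ne'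
  rw [Real.tanh_eq_sinh_div_cosh]
  rcases Int.units_eq_one_or s with rfl | rfl
  · rw [spin_one, one_mul, ← Real.cosh_add_sinh]; field_simp
  · rw [spin_neg_one, neg_one_mul, ← Real.cosh_sub_sinh]; field_simp; ring

theorem one_add_spin_mul_nonneg (s : ℤˣ) {a : ℝ} (h0 : 0 ≤ a) (h1 : a ≤ 1) :
    0 ≤ 1 + spin s * a := by
  rcases Int.units_eq_one_or s with rfl | rfl <;> simp only [spin_one, spin_neg_one] <;> linarith

/-- Extension of a spin configuration on `V` by `+1`. -/
def extend {V : Finset Vertex} (x : V → ℤˣ) (v : Vertex) : ℤˣ :=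
  if h : v ∈ V then x ⟨v, h⟩ else 1

theorem extend_of_mem {V : Finset Vertex} (x : V → ℤˣ) {v : Vertex} (h : v ∈ V) :
    extend x v = x ⟨v, h⟩ := dif_pos h

@[simp] theorem extend_coe {V : Finset Vertex} (x : V → ℤˣ) (v : V) : extend x v = x v :=
  extend_of_mem x v.2

/-! ### Boltzmann weights with magnetized leaves -/

/-- Energy of a configuration on the first `k` generations, leaving out the fields of
generation `k`. -/
noncomputable def energy (N : Vertex → ℕ) (β : ℝ) (B : Vertex → ℝ) : ℕ → (Vertex → ℤˣ) → ℝ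
  | 0, _ => 0
  | k + 1, σ => energy N β B k σ + ∑ v ∈ sphere N k, B v * spin (σ v) +
      β * ∑ w ∈ sphere N (k + 1), spin (σ w.tail) * spin (σ w)

/-- Boltzmann weight on the first `k` generations in which each vertex `v` of generation `k`, instead
of feeling a field, has a priori magnetization `a v`. -/
noncomputable def leafWeight (N : Vertex → ℕ) (β : ℝ) (B : Vertex → ℝ) (k : ℕ) (a : Vertex → ℝ)
    (σ : Vertex → ℤˣ) : ℝ :=
  Real.exp (energy N β B k σ) * ∏ v ∈ sphere N k, (1 + spin (σ v) * a v)

section Weight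

variable {N : Vertex → ℕ} {β : ℝ} {B : Vertex → ℝ}

theorem energy_congr {k : ℕ} {σ τ : Vertex → ℤˣ} (h : ∀ v ∈ ball N k, σ v = τ v) :
    energy N β B k σ = energy N β B k τ := by
  induction k with
  | zero => rfl
  | succ k ih =>
    simp only [energy]
    rw [ih fun v hv => h v (ball_mono (Nat.le_succ k) hv)]
    congr 2
    · refine Finset.sum_congr rfl fun v hv => ?_
      rw [h v (sphere_subset_ball (Nat.le_succ k) hv)]
    · refine Finset.sum_congr rfl fun v hv => ?_
      rw [h v (sphere_subset_ball le_rfl hv),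
        h _ (sphere_subset_ball (Nat.le_succ k) (tail_mem_sphere hv))]

theorem energy_add_sum_sphere (k : ℕ) (σ : Vertex → ℤˣ) :
    energy N β B k σ + ∑ v ∈ sphere N k, B v * spin (σ v) =
      β * (∑ v ∈ ball N k, if v = [] then 0 else spin (σ v.tail) * spin (σ v)) +
        ∑ v ∈ ball N k, B v * spin (σ v) := by
  induction k with
  | zero => simp [energy, ball_zero, sphere]
  | succ k ih =>
    have hne : ∑ v ∈ sphere N (k + 1), (if v = [] then 0 else spin (σ v.tail) * spin (σ v)) =
        ∑ v ∈ sphere N (k + 1), spin (σ v.tail) * spin (σ v) := by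
      refine Finset.sum_congr rfl fun v hv => if_neg ?_
      rintro rfl
      simpa using length_of_mem_sphere hv
    rw [energy, ball_succ, Finset.sum_disjUnion, Finset.sum_disjUnion, hne]
    linarith

theorem sum_isParent {k : ℕ} (x : ball N k → ℤˣ) :
    (∑ i : ball N k, ∑ j : ball N k, if IsParent (i : Vertex) (j : Vertex) then
      spin (x i) * spin (x j) else 0) =
    ∑ v ∈ ball N k, if v = [] then 0 else spin (extend x v.tail) * spin (extend x v) := by
  rw [Finset.sum_comm, ← Finset.sum_coe_sort (ball N k)]
  refine Finset.sum_congr rfl fun j _ => ?_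
  by_cases hj : (j : Vertex) = []
  · simp [IsParent, hj]
  · have ht : (j : Vertex).tail ∈ ball N k := by
      obtain ⟨m, hm, hv⟩ := mem_ball.1 j.2
      cases m with
      | zero => simp [sphere] at hv; exact absurd hv hj
      | succ m => exact mem_ball.2 ⟨m, by omega, tail_mem_sphere hv⟩
    rw [if_neg hj, Finset.sum_eq_single ⟨_, ht⟩]
    · simp [IsParent, hj, extend_of_mem x ht]
    · intro b _ hb
      refine if_neg fun h => hb (Subtype.ext h.2.symm)
    · simp

theorem weight_eq {k : ℕ} (x : ball N k → ℤˣ) :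
    weight β B (ball N k) x = Real.exp (energy N β B k (extend x)) *
      ∏ v ∈ sphere N k, Real.exp (spin (extend x v) * B v) := by
  rw [← Real.exp_sum, ← Real.exp_add]
  simp_rw [mul_comm _ (B _)]
  rw [energy_add_sum_sphere, weight, sum_isParent, ← Finset.sum_coe_sort (ball N k)
    (fun v => B v * spin (extend x v))]
  simp

theorem weight_eq_leafWeight {k : ℕ} (x : ball N k → ℤˣ) :
    weight β B (ball N k) x = (∏ v ∈ sphere N k, Real.cosh (B v)) *
      leafWeight N β B k (fun v => Real.tanh (B v)) (extend x) := by
  rw [weight_eq, leafWeight, mul_left_comm, ← Finset.prod_mul_distrib]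
  simp_rw [exp_spin_mul]

theorem plusWeight_eq_leafWeight {k : ℕ} (x : ball N k → ℤˣ) :
    plusWeight N β B k x = (∏ v ∈ sphere N k, (Real.exp (B v) / 2)) *
      leafWeight N β B k (fun _ => 1) (extend x) := by
  rw [plusWeight, leafWeight, mul_left_comm, ← Finset.prod_mul_distrib]
  split_ifs with h
  · rw [weight_eq]
    congr 1
    refine Finset.prod_congr rfl fun v hv => ?_
    have hb := sphere_subset_ball le_rfl hv
    rw [extend_of_mem x hb, h ⟨v, hb⟩ (length_of_mem_sphere hv), spin_one]
    ring_nf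
  · push Not at h
    obtain ⟨v, hv, hx⟩ := h
    have hs : (v : Vertex) ∈ sphere N k := by
      obtain ⟨j, -, hj⟩ := mem_ball.1 v.2
      exact ((length_of_mem_sphere hj).symm.trans hv) ▸ hj
    rw [Finset.prod_eq_zero hs, mul_zero]
    rw [extend_coe, (Int.units_eq_one_or _).resolve_left hx, spin_neg_one]
    ring

/-- Summing over the spin of a child with a priori magnetization `a` produces, up to the positive
constant `c`, the Boltzmann factor of a field `u` on its parent. -/
def Transmits (β a c u : ℝ) : Prop :=
  0 < c ∧ ∀ s : ℤˣ, ∑ y : ℤˣ, Real.exp (β * (spin s * spin y)) * (1 + spin y * a) =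
    c * Real.exp (spin s * u)

theorem transmits_one (β : ℝ) : Transmits β 1 2 β := by
  refine ⟨two_pos, fun s => ?_⟩
  rw [sum_spin, spin_one, spin_neg_one]
  ring_nf

theorem transmits_tanh (β h : ℝ) : Transmits β (Real.tanh h)
    (2 * Real.exp ((Real.log (Real.cosh (h + β)) + Real.log (Real.cosh (h - β))) / 2) /
      Real.cosh h) (message β h) := by
  have hc := Real.cosh_pos h
  refine ⟨by positivity, fun s => ?_⟩
  have key : ∑ y : ℤˣ, Real.exp (β * (spin s * spin y)) * (1 + spin y * Real.tanh h) =
      2 * Real.cosh (h + spin s * β) / Real.cosh h := by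
    have (y : ℤˣ) : Real.exp (β * (spin s * spin y)) * (1 + spin y * Real.tanh h) =
        Real.exp (spin y * (h + spin s * β)) / Real.cosh h := by
      rw [eq_div_iff hc.ne', mul_assoc, mul_comm _ (Real.cosh h), ← exp_spin_mul, ← Real.exp_add]
      ring_nf
    simp_rw [this]
    rw [← Finset.sum_div, sum_spin, spin_one, spin_neg_one, Real.cosh_eq (h + spin s * β)]
    ring_nf
  rw [key, div_mul_eq_mul_div, mul_assoc, ← Real.exp_add]
  congr 2
  unfold message
  rcases Int.units_eq_one_or s with rfl | rfl
  · rw [spin_one, one_mul, one_mul]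
    nth_rewrite 1 [← Real.exp_log (Real.cosh_pos (h + β))]
    ring_nf
  · rw [spin_neg_one, neg_one_mul, neg_one_mul, ← sub_eq_add_neg]
    nth_rewrite 1 [← Real.exp_log (Real.cosh_pos (h - β))]
    ring_nf

/-- The configuration on the disjoint union of `R` and `S` that is `z` on `R` and `y` on `S`. -/
def glue {V R S : Finset Vertex} {hRS : Disjoint R S} (hV : V = R.disjUnion S hRS)
    (z : R → ℤˣ) (y : S → ℤˣ) (v : V) : ℤˣ :=
  if h : (v : Vertex) ∈ R then z ⟨v, h⟩
  else y ⟨v, (Finset.mem_disjUnion.1 ((Finset.ext_iff.1 hV v).1 v.2)).resolve_left h⟩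

/-- A marginal on `R` of a function on configurations on the disjoint union of `R` and `S` is a sum
over configurations on `S`. -/
theorem marginal_disjUnion {V R S : Finset Vertex} (hRS : Disjoint R S)
    (hV : V = R.disjUnion S hRS) (f : (V → ℤˣ) → ℝ) (z : R → ℤˣ) :
    marginal R f z = ∑ y : S → ℤˣ, f (glue hV z y) := by
  rw [marginal, ← Finset.sum_filter]
  refine Finset.sum_bij' (fun x _ w => x ⟨w, by rw [hV, Finset.mem_disjUnion]; exact Or.inr w.2⟩)
    (fun y _ => glue hV z y)
    ?_ ?_ ?_ ?_ ?_
  · simp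
  · intro y _
    simp only [Finset.mem_filter, Finset.mem_univ, true_and]
    intro i hi
    exact dif_pos hi
  · intro x hx
    simp only [Finset.mem_filter, Finset.mem_univ, true_and] at hx
    funext v
    unfold glue
    split_ifs with h
    · exact (hx v h).symm
    · rfl
  · intro y _
    funext w
    exact dif_neg (Finset.disjoint_right.1 hRS w.2)
  · intro x hx
    simp only [Finset.mem_filter, Finset.mem_univ, true_and] at hx
    congr 1
    funext v
    unfold glue
    split_ifs with h
    · exact hx v h
    · rfl

/-- Summing over the spins of generation `k + 1` turns a priori magnetizations of that generation
into a priori magnetizations of generation `k`. -/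
theorem marginal_leafWeight_succ (k : ℕ) {a c u : Vertex → ℝ}
    (h : ∀ w, Transmits β (a w) (c w) (u w)) :
    ∃ C > 0, ∀ z : ball N k → ℤˣ,
      marginal (ball N k) (fun x : ball N (k + 1) → ℤˣ => leafWeight N β B (k + 1) a (extend x)) z =
        C * leafWeight N β B k
          (fun v => Real.tanh (B v + ∑ i ∈ Finset.range (N v), u (i :: v))) (extend z) := by
  refine ⟨∏ v ∈ sphere N k, ((∏ i ∈ Finset.range (N v), c (i :: v)) *
    Real.cosh (B v + ∑ i ∈ Finset.range (N v), u (i :: v))), ?_, fun z => ?_⟩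
  · exact Finset.prod_pos fun v _ => mul_pos (Finset.prod_pos fun i _ => (h _).1) (Real.cosh_pos _)
  rw [marginal_disjUnion (disjoint_ball_sphere k) (ball_succ k)]
  set g : Vertex → ℤˣ → ℝ := fun w s =>
    Real.exp (β * (spin (extend z w.tail) * spin s)) * (1 + spin s * a w) with hg
  have hterm : ∀ y : sphere N (k + 1) → ℤˣ,
      leafWeight N β B (k + 1) a (extend (glue (ball_succ k) z y)) =
      Real.exp (energy N β B k (extend z)) *
        (∏ v ∈ sphere N k, Real.exp (spin (extend z v) * B v)) *
          ∏ w : sphere N (k + 1), g w (y w) := by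
    intro y
    set x : ball N (k + 1) → ℤˣ := glue (ball_succ k) z y with hx
    have hxz : ∀ v ∈ ball N k, extend x v = extend z v := fun v hv => by
      rw [extend_of_mem x (ball_mono (Nat.le_succ k) hv), extend_of_mem z hv, hx]
      exact dif_pos hv
    have hxy : ∀ w (hw : w ∈ sphere N (k + 1)), extend x w = y ⟨w, hw⟩ := fun w hw => by
      rw [extend_of_mem x (sphere_subset_ball le_rfl hw), hx]
      exact dif_neg (Finset.disjoint_right.1 (disjoint_ball_sphere k) hw)
    rw [leafWeight, energy, energy_congr hxz, Real.exp_add, Real.exp_add, Real.exp_sum,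
      Finset.mul_sum, Real.exp_sum, mul_assoc, ← Finset.prod_mul_distrib]
    congr 1
    · congr 1
      refine Finset.prod_congr rfl fun v hv => ?_
      rw [hxz v (sphere_subset_ball le_rfl hv), mul_comm]
    · rw [← Finset.prod_coe_sort]
      refine Finset.prod_congr rfl fun w _ => ?_
      rw [hxy w w.2, hxz _ (sphere_subset_ball le_rfl (tail_mem_sphere w.2)), hg]
  simp_rw [hterm]
  rw [← Finset.mul_sum]
  have hprod : ∑ y : sphere N (k + 1) → ℤˣ, ∏ w : sphere N (k + 1), g w (y w) =
      ∏ w : sphere N (k + 1), ∑ s, g w s := by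
    rw [Finset.prod_univ_sum, Fintype.piFinset_univ]
  rw [hprod, Finset.prod_coe_sort (sphere N (k + 1)) (fun w => ∑ s, g w s), prod_sphere_succ,
    leafWeight, mul_assoc, mul_left_comm _ (Real.exp _), ← Finset.prod_mul_distrib,
    ← Finset.prod_mul_distrib]
  congr 1
  refine Finset.prod_congr rfl fun v _ => ?_
  rw [mul_assoc, ← exp_spin_mul, mul_add, Real.exp_add, mul_left_comm]
  congr 1
  rw [Finset.mul_sum, Real.exp_sum, ← Finset.prod_mul_distrib]
  exact Finset.prod_congr rfl fun i _ => (h _).2 _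

end Weight

/-! ### Marginals and total variation -/

section Marginal

variable {U R V : Finset Vertex}

/-- Exactly one configuration on `R ⊆ V` is the restriction of a given configuration on `V`. -/
theorem sum_ite_restrict (hR : R ⊆ V) (x : V → ℤˣ) (f : (R → ℤˣ) → ℝ) :
    (∑ z : R → ℤˣ, if ∀ (i : V) (hi : (i : Vertex) ∈ R), x i = z ⟨i, hi⟩ then f z else 0) =
      f fun i => x ⟨i, hR i.2⟩ := by
  rw [Finset.sum_eq_single fun i : R => x ⟨i, hR i.2⟩]
  · simp
  · intro z _ hz
    refine if_neg fun h => hz ?_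
    funext i
    exact (h ⟨i, hR i.2⟩ i.2).symm
  · simp

theorem marginal_self (μ : (V → ℤˣ) → ℝ) : marginal V μ = μ := by
  funext y
  rw [marginal, Finset.sum_eq_single y]
  · simp
  · intro x _ hx
    refine if_neg fun h => hx ?_
    funext i
    exact h i i.2
  · simp

theorem marginal_marginal (hUR : U ⊆ R) (hR : R ⊆ V) (μ : (V → ℤˣ) → ℝ) :
    marginal U (marginal R μ) = marginal U μ := by
  funext y
  simp only [marginal]
  have : ∀ z : R → ℤˣ, (if ∀ (i : R) (hi : (i : Vertex) ∈ U), z i = y ⟨i, hi⟩ then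
      ∑ x : V → ℤˣ, (if ∀ (i : V) (hi : (i : Vertex) ∈ R), x i = z ⟨i, hi⟩ then μ x else 0)
      else 0) =
    ∑ x : V → ℤˣ, if ∀ (i : V) (hi : (i : Vertex) ∈ R), x i = z ⟨i, hi⟩ then
      (if ∀ (i : R) (hi : (i : Vertex) ∈ U), z i = y ⟨i, hi⟩ then μ x else 0) else 0 := by
    intro z
    split_ifs <;> simp
  simp_rw [this]
  rw [Finset.sum_comm]
  refine Finset.sum_congr rfl fun x _ => ?_
  rw [sum_ite_restrict hR x
    (fun z => if ∀ (i : R) (hi : (i : Vertex) ∈ U), z i = y ⟨i, hi⟩ then μ x else 0)]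
  refine if_congr ⟨fun h i hi => h ⟨i, hUR hi⟩ hi, fun h i hi => h ⟨i, hR i.2⟩ hi⟩ rfl rfl

theorem sum_marginal (hR : R ⊆ V) (μ : (V → ℤˣ) → ℝ) :
    ∑ z, marginal R μ z = ∑ x, μ x := by
  simp only [marginal]
  rw [Finset.sum_comm]
  exact Finset.sum_congr rfl fun x _ => sum_ite_restrict hR x fun _ => μ x

theorem marginal_const_mul (c : ℝ) (μ : (V → ℤˣ) → ℝ) (y : U → ℤˣ) :
    marginal U (fun x => c * μ x) y = c * marginal U μ y := by
  simp [marginal, Finset.mul_sum]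

theorem marginal_normalize (hR : R ⊆ V) {W : (V → ℤˣ) → ℝ} {g : (R → ℤˣ) → ℝ} {c : ℝ} (hc : c ≠ 0)
    (h : ∀ z, marginal R W z = c * g z) (z : R → ℤˣ) :
    marginal R (fun x => W x / ∑ x', W x') z = g z / ∑ z', g z' := by
  simp_rw [div_eq_inv_mul]
  rw [marginal_const_mul, h, ← sum_marginal hR]
  simp_rw [h]
  rw [← Finset.mul_sum, mul_inv, mul_mul_mul_comm, inv_mul_cancel₀ hc, one_mul]

theorem tvDist_marginal_le (hU : U ⊆ V) (p q : (V → ℤˣ) → ℝ) :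
    tvDist (marginal U p) (marginal U q) ≤ tvDist p q := by
  unfold tvDist
  refine mul_le_mul_of_nonneg_left ?_ (by norm_num)
  calc ∑ y, |marginal U p y - marginal U q y|
      ≤ ∑ y, marginal U (fun x => |p x - q x|) y := by
        refine Finset.sum_le_sum fun y _ => ?_
        simp only [marginal]
        rw [← Finset.sum_sub_distrib]
        refine (Finset.abs_sum_le_sum_abs _ _).trans (Finset.sum_le_sum fun x _ => ?_)
        split_ifs <;> simp
    _ = _ := sum_marginal hU _

end Marginal

theorem tvDist_normalize_le {α : Type*} [Fintype α] {f g : α → ℝ} (hf : 0 < ∑ a, f a)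
    (hg : 0 < ∑ a, g a) (hg0 : ∀ a, 0 ≤ g a) :
    tvDist (fun a => f a / ∑ a', f a') (fun a => g a / ∑ a', g a') ≤
      (∑ a, |f a - g a|) / ∑ a, f a := by
  set F := ∑ a, f a
  set G := ∑ a, g a
  have hFG : |G - F| ≤ ∑ a, |f a - g a| := by
    rw [abs_sub_comm, ← Finset.sum_sub_distrib]
    exact Finset.abs_sum_le_sum_abs _ _
  have h1 : ∀ a, |f a / F - g a / G| ≤ |f a - g a| / F + g a * (|G - F| / (F * G)) := by
    intro a
    have e : f a / F - g a / G = (f a - g a) / F + g a * ((G - F) / (F * G)) := by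
      field_simp; ring
    rw [e]
    refine (abs_add_le _ _).trans_eq ?_
    rw [abs_div, abs_mul, abs_div, abs_of_pos hf, abs_of_pos (mul_pos hf hg), abs_of_nonneg (hg0 a)]
  have h2 := Finset.sum_le_sum fun a (_ : a ∈ Finset.univ) => h1 a
  rw [Finset.sum_add_distrib, ← Finset.sum_div, ← Finset.sum_mul] at h2
  have h3 : G * (|G - F| / (F * G)) ≤ (∑ a, |f a - g a|) / F := by
    have : G * (|G - F| / (F * G)) = |G - F| / F := by field_simp
    rw [this]
    gcongr
  unfold tvDist
  linarith

theorem abs_prod_sub_prod_le {ι : Type*} (s : Finset ι) {f g : ι → ℝ} {δ : ℝ} (hδ : 0 ≤ δ)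
    (hf : ∀ i ∈ s, |f i| ≤ 2) (hg : ∀ i ∈ s, |g i| ≤ 2) (hfg : ∀ i ∈ s, |f i - g i| ≤ δ) :
    |∏ i ∈ s, f i - ∏ i ∈ s, g i| ≤ s.card * 2 ^ s.card * δ := by
  classical
  induction s using Finset.induction_on with
  | empty => simp
  | insert i s hi ih =>
    simp only [Finset.forall_mem_insert] at hf hg hfg
    rw [Finset.prod_insert hi, Finset.prod_insert hi, Finset.card_insert_of_notMem hi]
    have e : f i * ∏ j ∈ s, f j - g i * ∏ j ∈ s, g j =
      f i * (∏ j ∈ s, f j - ∏ j ∈ s, g j) + (f i - g i) * ∏ j ∈ s, g j := by ring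
    have hp : |∏ j ∈ s, g j| ≤ 2 ^ s.card := by
      rw [Finset.abs_prod]
      exact (Finset.prod_le_prod (fun j _ => abs_nonneg _) hg.2).trans_eq (by simp)
    have h1 := mul_le_mul hf.1 (ih hf.2 hg.2 hfg.2) (abs_nonneg _) (by norm_num)
    have h2 := mul_le_mul hfg.1 hp (abs_nonneg _) hδ
    rw [e]
    refine (abs_add_le _ _).trans ?_
    rw [abs_mul, abs_mul]
    push_cast
    have h3 : 0 ≤ (2 : ℝ) ^ s.card * δ := by positivity
    rw [pow_succ]
    nlinarith

/-! ### Comparison of the two boundary conditions -/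

section Comparison

variable {N : Vertex → ℕ} {β : ℝ} {B : Vertex → ℝ}

theorem marginal_leafWeight_tanh (k n : ℕ) (h : Vertex → ℝ) :
    ∃ C > 0, ∀ z : ball N k → ℤˣ,
      marginal (ball N k) (fun x : ball N (k + n) → ℤˣ =>
        leafWeight N β B (k + n) (fun v => Real.tanh (h v)) (extend x)) z =
      C * leafWeight N β B k (fun v => Real.tanh ((fieldStep N β B)^[n] h v)) (extend z) := by
  induction n generalizing h with
  | zero => exact ⟨1, one_pos, fun z => by rw [one_mul]; exact congrFun (marginal_self _) z⟩
  | succ n ih =>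
    obtain ⟨C₁, hC₁, h₁⟩ := marginal_leafWeight_succ (N := N) (B := B) (k + n)
      (fun w => transmits_tanh β (h w))
    obtain ⟨C₂, hC₂, h₂⟩ := ih (fieldStep N β B h)
    refine ⟨C₁ * C₂, mul_pos hC₁ hC₂, fun z => ?_⟩
    rw [← marginal_marginal (R := ball N (k + n)) (ball_mono (Nat.le_add_right k n))
      (ball_mono (Nat.le_succ _)), mul_assoc, Function.iterate_succ_apply, ← h₂ z,
      ← marginal_const_mul]
    congr 1
    funext x
    exact h₁ x

theorem marginal_isingFree (r n : ℕ) (z : ball N r → ℤˣ) :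
    marginal (ball N r) (isingFree N β B (r + n)) z =
      leafWeight N β B r (fun v => Real.tanh ((fieldStep N β B)^[n] B v)) (extend z) /
        ∑ z' : ball N r → ℤˣ,
          leafWeight N β B r (fun v => Real.tanh ((fieldStep N β B)^[n] B v)) (extend z') := by
  obtain ⟨C, hC, h⟩ := marginal_leafWeight_tanh (N := N) (β := β) (B := B) r n B
  have hp : 0 < ∏ v ∈ sphere N (r + n), Real.cosh (B v) :=
    Finset.prod_pos fun v _ => Real.cosh_pos _
  refine marginal_normalize (W := weight β B (ball N (r + n)))
    (g := fun z => leafWeight N β B r (fun v => Real.tanh ((fieldStep N β B)^[n] B v)) (extend z))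
    (ball_mono (Nat.le_add_right r n)) (mul_pos hp hC).ne' (fun z => ?_) z
  rw [funext weight_eq_leafWeight]
  rw [marginal_const_mul, h, mul_assoc]

theorem marginal_isingPlus (r n : ℕ) (z : ball N r → ℤˣ) :
    marginal (ball N r) (isingPlus N β B (r + (n + 1))) z =
      leafWeight N β B r (fun v => Real.tanh ((fieldStep N β B)^[n] (plusField N β B) v))
          (extend z) /
        ∑ z' : ball N r → ℤˣ, leafWeight N β B r
          (fun v => Real.tanh ((fieldStep N β B)^[n] (plusField N β B) v)) (extend z') := by
  obtain ⟨C₁, hC₁, h₁⟩ := marginal_leafWeight_succ (N := N) (B := B) (r + n)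
    (fun _ => transmits_one β)
  obtain ⟨C₂, hC₂, h₂⟩ := marginal_leafWeight_tanh (N := N) (β := β) (B := B) r n
    (plusField N β B)
  have hp : 0 < ∏ v ∈ sphere N (r + (n + 1)), (Real.exp (B v) / 2) :=
    Finset.prod_pos fun v _ => by positivity
  refine marginal_normalize (W := plusWeight N β B (r + (n + 1)))
    (g := fun z => leafWeight N β B r
      (fun v => Real.tanh ((fieldStep N β B)^[n] (plusField N β B) v)) (extend z))
    (ball_mono (Nat.le_add_right r _)) (mul_pos hp (mul_pos hC₁ hC₂)).ne' (fun z => ?_) z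
  rw [funext plusWeight_eq_leafWeight]
  rw [marginal_const_mul, mul_assoc]
  congr 1
  rw [mul_assoc, ← h₂, ← marginal_const_mul, ← marginal_marginal (R := ball N (r + n))
    (ball_mono (Nat.le_add_right r n)) (ball_mono (Nat.le_succ _))]
  congr 1
  funext x
  refine (h₁ x).trans ?_
  simp [plusField]

theorem abs_energy_le {b : ℝ} (hβ : 0 ≤ β) (hb : 0 ≤ b) {k : ℕ}
    (hB : ∀ v ∈ ball N k, v.length < k → |B v| ≤ b) (σ : Vertex → ℤˣ) :
    |energy N β B k σ| ≤ (β + b) * (ball N k).card := by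
  -- The fields of generation `k` enter only the next energy; reserving room for them
  -- makes the induction go through.
  suffices ∀ j ≤ k, |energy N β B j σ| + b * (sphere N j).card ≤ (β + b) * (ball N j).card by
    have := this k le_rfl
    have : 0 ≤ b * (sphere N k).card := by positivity
    linarith
  intro j
  induction j with
  | zero =>
    intro _
    simp [energy, ball_zero, sphere, hβ]
  | succ j ih =>
    intro hj
    have ih := ih (by omega)
    have h1 : |∑ v ∈ sphere N j, B v * spin (σ v)| ≤ b * (sphere N j).card := by
      refine (Finset.abs_sum_le_sum_abs _ _).trans ?_
      rw [mul_comm, ← nsmul_eq_mul, ← Finset.sum_const]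
      refine Finset.sum_le_sum fun v hv => ?_
      rw [abs_mul, abs_spin, mul_one]
      exact hB v (sphere_subset_ball (by omega) hv) (by rw [length_of_mem_sphere hv]; omega)
    have h2 : |∑ w ∈ sphere N (j + 1), spin (σ w.tail) * spin (σ w)| ≤
        (sphere N (j + 1)).card := by
      refine (Finset.abs_sum_le_sum_abs _ _).trans ?_
      simp [abs_mul, abs_spin]
    have h3 := mul_le_mul_of_nonneg_left h2 hβ
    rw [energy, ball_succ, Finset.card_disjUnion]
    have h4 := abs_add_le (energy N β B j σ + ∑ v ∈ sphere N j, B v * spin (σ v))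
      (β * ∑ w ∈ sphere N (j + 1), spin (σ w.tail) * spin (σ w))
    have h5 := abs_add_le (energy N β B j σ) (∑ v ∈ sphere N j, B v * spin (σ v))
    rw [abs_mul β, abs_of_nonneg hβ] at h4
    push_cast
    linarith

theorem leafWeight_nonneg {k : ℕ} {a : Vertex → ℝ} (h0 : ∀ v, 0 ≤ a v) (h1 : ∀ v, a v ≤ 1)
    (σ : Vertex → ℤˣ) : 0 ≤ leafWeight N β B k a σ :=
  mul_nonneg (Real.exp_pos _).le
    (Finset.prod_nonneg fun v _ => one_add_spin_mul_nonneg _ (h0 v) (h1 v))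

theorem exp_neg_le_sum_leafWeight {b : ℝ} (hβ : 0 ≤ β) (hb : 0 ≤ b) {k : ℕ}
    (hB : ∀ v ∈ ball N k, v.length < k → |B v| ≤ b) {a : Vertex → ℝ} (h0 : ∀ v, 0 ≤ a v)
    (h1 : ∀ v, a v ≤ 1) :
    Real.exp (-((β + b) * (ball N k).card)) ≤
      ∑ z : ball N k → ℤˣ, leafWeight N β B k a (extend z) := by
  -- The configuration with all spins `+1` alone has this weight.
  refine le_trans ?_ (Finset.single_le_sum (fun z _ => leafWeight_nonneg h0 h1 _)
    (Finset.mem_univ fun _ => (1 : ℤˣ)))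
  have he : extend (fun _ : ball N k => (1 : ℤˣ)) = fun _ => 1 := by
    funext v; simp [extend]
  rw [he, leafWeight]
  have hp : 1 ≤ ∏ v ∈ sphere N k, (1 + spin 1 * a v) := by
    calc (1 : ℝ) = ∏ v ∈ sphere N k, 1 := by simp
      _ ≤ _ := by
        refine Finset.prod_le_prod (by simp) fun v _ => ?_
        rw [spin_one]
        linarith [h0 v]
  refine le_trans (Real.exp_le_exp.2 ?_) (le_mul_of_one_le_right (Real.exp_pos _).le hp)
  exact (abs_le.1 (abs_energy_le hβ hb hB _)).1

theorem tvDist_leafWeight_le {b δ : ℝ} (hβ : 0 ≤ β) (hb : 0 ≤ b) (hδ : 0 ≤ δ) {k : ℕ}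
    (hB : ∀ v ∈ ball N k, v.length < k → |B v| ≤ b) {a a' : Vertex → ℝ}
    (h0 : ∀ v, 0 ≤ a v) (h1 : ∀ v, a v ≤ 1) (h0' : ∀ v, 0 ≤ a' v) (h1' : ∀ v, a' v ≤ 1)
    (haa : ∀ v, |a v - a' v| ≤ δ) :
    tvDist (fun z : ball N k → ℤˣ => leafWeight N β B k a (extend z) /
        ∑ z' : ball N k → ℤˣ, leafWeight N β B k a (extend z'))
      (fun z : ball N k → ℤˣ => leafWeight N β B k a' (extend z) /
        ∑ z' : ball N k → ℤˣ, leafWeight N β B k a' (extend z')) ≤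
      δ * (8 * Real.exp (2 * (β + b))) ^ (ball N k).card := by
  set n := (ball N k).card with hn
  have hs : (sphere N k).card ≤ n := Finset.card_le_card (sphere_subset_ball le_rfl)
  have hF := exp_neg_le_sum_leafWeight hβ hb hB h0 h1
  have hG := exp_neg_le_sum_leafWeight hβ hb hB h0' h1'
  have hE := Real.exp_pos (-((β + b) * n))
  have hdiff : ∀ z : ball N k → ℤˣ,
      |leafWeight N β B k a (extend z) - leafWeight N β B k a' (extend z)| ≤
        Real.exp ((β + b) * n) * (2 ^ n * 2 ^ n * δ) := by
    intro z
    rw [leafWeight, leafWeight, ← mul_sub, abs_mul, Real.abs_exp]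
    refine mul_le_mul (Real.exp_le_exp.2 (abs_le.1 (abs_energy_le hβ hb hB _)).2) ?_
      (abs_nonneg _) (Real.exp_pos _).le
    have habs : ∀ (c : Vertex → ℝ), (∀ v, 0 ≤ c v) → (∀ v, c v ≤ 1) → ∀ v ∈ sphere N k,
        |1 + spin (extend z v) * c v| ≤ 2 := by
      intro c hc0 hc1 v _
      refine (abs_add_le _ _).trans ?_
      rw [abs_mul, abs_spin, abs_one, abs_of_nonneg (hc0 v)]
      linarith [hc1 v]
    refine (abs_prod_sub_prod_le _ hδ (habs a h0 h1) (habs a' h0' h1') fun v _ => ?_).trans ?_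
    · rw [add_sub_add_left_eq_sub, ← mul_sub, abs_mul, abs_spin, one_mul]
      exact haa v
    · have hs1 : ((sphere N k).card : ℝ) ≤ 2 ^ n := by
        exact_mod_cast hs.trans Nat.lt_two_pow_self.le
      have hs2 : (2 : ℝ) ^ (sphere N k).card ≤ 2 ^ n := pow_le_pow_right₀ (by norm_num) hs
      gcongr
  refine (tvDist_normalize_le (hE.trans_le hF) (hE.trans_le hG)
    fun z => leafWeight_nonneg h0' h1' _).trans ?_
  rw [div_le_iff₀ (hE.trans_le hF)]
  have hcard : ∑ z : ball N k → ℤˣ,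
      |leafWeight N β B k a (extend z) - leafWeight N β B k a' (extend z)| ≤
        2 ^ n * (Real.exp ((β + b) * n) * (2 ^ n * 2 ^ n * δ)) := by
    refine (Finset.sum_le_sum fun z _ => hdiff z).trans_eq ?_
    simp [hn]
  refine hcard.trans (le_trans (le_of_eq ?_) (mul_le_mul_of_nonneg_left hF (by positivity)))
  have e1 : Real.exp (2 * (β + b)) ^ n = Real.exp ((β + b) * n) * Real.exp ((β + b) * n) := by
    rw [← Real.exp_nat_mul, ← Real.exp_add]
    ring_nf
  have e2 : Real.exp ((β + b) * n) * Real.exp (-((β + b) * n)) = 1 := by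
    rw [← Real.exp_add, add_neg_cancel, Real.exp_zero]
  have e3 : (8 : ℝ) ^ n = 2 ^ n * 2 ^ n * 2 ^ n := by
    rw [← mul_pow, ← mul_pow]; norm_num
  rw [mul_pow, e1, e3]
  linear_combination (-(2 ^ n * 2 ^ n * 2 ^ n * δ * Real.exp ((β + b) * n))) * e2

theorem weight_congr {V : Finset Vertex} {B' : Vertex → ℝ} (h : ∀ v ∈ V, B v = B' v) :
    weight β B V = weight β B' V := by
  funext x
  simp only [weight]
  congr 2
  exact Finset.sum_congr rfl fun i _ => by rw [h i i.2]

/-- The quenched bound, valid on every locally finite tree. -/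
theorem tvDist_plus_free_le {βmax b₀ b₁ : ℝ} {r ℓ : ℕ} {U : Finset Vertex} (hβ : 0 ≤ β)
    (hβm : β ≤ βmax) (hb₀ : 0 < b₀) (hb : b₀ ≤ b₁) (hrℓ : r < ℓ)
    (hBmax : ∀ v ∈ ball N r, v.length < r → B v ≤ b₁) (hBmin : ∀ v ∈ ball N ℓ, b₀ ≤ B v)
    (hU : U ⊆ ball N r) :
    tvDist (marginal U (isingPlus N β B ℓ)) (marginal U (isingFree N β B ℓ)) ≤
      messageRatio βmax b₀ / ((ℓ - r : ℕ) : ℝ) *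
        (8 * Real.exp (2 * (βmax + b₁))) ^ (ball N r).card := by
  -- The fields outside the first `ℓ` generations are irrelevant, so they may be replaced by `b₀`.
  set B' : Vertex → ℝ := fun v => if v ∈ ball N ℓ then B v else b₀ with hB'
  have hBB' : ∀ v ∈ ball N ℓ, B v = B' v := fun v hv => (if_pos hv).symm
  have hmin : ∀ v, b₀ ≤ B' v := by
    intro v
    simp only [hB']
    split_ifs with h
    · exact hBmin v h
    · exact le_rfl
  have hmax : ∀ v ∈ ball N r, v.length < r → |B' v| ≤ b₁ := by
    intro v hv hl
    rw [abs_of_pos (hb₀.trans_le (hmin v)), ← hBB' v (ball_mono hrℓ.le hv)]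
    exact hBmax v hv hl
  have hplus : isingPlus N β B ℓ = isingPlus N β B' ℓ := by
    unfold isingPlus plusWeight
    rw [weight_congr hBB']
  have hfree : isingFree N β B ℓ = isingFree N β B' ℓ := by
    unfold isingFree
    rw [weight_congr hBB']
  obtain ⟨n, rfl⟩ : ∃ n, ℓ = r + (n + 1) := ⟨ℓ - r - 1, by omega⟩
  rw [hplus, hfree, ← marginal_marginal hU (ball_mono hrℓ.le),
    ← marginal_marginal hU (ball_mono hrℓ.le)]
  refine (tvDist_marginal_le hU _ _).trans ?_
  rw [funext (marginal_isingPlus r n), funext (marginal_isingFree r (n + 1)),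
    show r + (n + 1) - r = n + 1 by omega]
  have hB0 : 0 ≤ B' := fun v => hb₀.le.trans (hmin v)
  have hp0 : 0 ≤ plusField N β B' := fun v => add_nonneg (hB0 v) (by positivity)
  have hn : (0 : ℝ) < ((n + 1 : ℕ) : ℝ) := by positivity
  have hK : 0 ≤ messageRatio βmax b₀ :=
    div_nonneg (hβ.trans hβm) (message_nonneg (hβ.trans hβm) hb₀.le)
  have hδ : 0 ≤ messageRatio βmax b₀ / ((n + 1 : ℕ) : ℝ) := by positivity
  refine (tvDist_leafWeight_le hβ (hb₀.le.trans hb) hδ hmax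
    (fun v => tanh_nonneg (iterate_fieldStep_nonneg hβ hB0 hp0 n v)) (fun v => tanh_le_one _)
    (fun v => tanh_nonneg (iterate_fieldStep_nonneg hβ hB0 hB0 (n + 1) v))
    (fun v => tanh_le_one _) fun v => ?_).trans ?_
  · rw [abs_of_nonneg (sub_nonneg.2 (magnetization_free_le_plus hβ n v)), le_div_iff₀ hn, mul_comm]
    exact magnetization_gap_le hβ hβm hb₀ hmin n v
  · gcongr

end Comparison

end IsingTree

theorem mainTheorem5 :
    ∃ (M : ℝ → ℝ → ℝ≥0 → ℝ≥0) (C : ℝ → ℝ → ℝ≥0),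
      ∀ (Δ : ℝ≥0) (Bmin Bmax βmax : ℝ), 0 < Bmin → Bmin ≤ Bmax →
      ∀ (Ω : Type*) [MeasurableSpace Ω] (P : Measure Ω) [IsProbabilityMeasure P]
        (N : Ω → IsingTree.Vertex → ℕ), IsingTree.IsCondIndepTree P N Δ →
      ∀ (r ℓ : ℕ), r < ℓ →
      ∀ (B : Ω → IsingTree.Vertex → ℝ), (∀ v, Measurable fun ω => B ω v) →
        (∀ᵐ ω ∂P, ∀ v ∈ IsingTree.ball (N ω) r, v.length < r → B ω v ≤ Bmax) →
        (∀ᵐ ω ∂P, ∀ v ∈ IsingTree.ball (N ω) ℓ, Bmin ≤ B ω v) →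
      ∀ (U : Ω → Finset IsingTree.Vertex), (∀ s, MeasurableSet {ω | U ω = s}) →
        (∀ᵐ ω ∂P, U ω ⊆ IsingTree.ball (N ω) r) →
      ∀ β : ℝ, 0 ≤ β → β ≤ βmax →
        ∫⁻ ω, ENNReal.ofReal (IsingTree.tvDist
            (IsingTree.marginal (U ω) (IsingTree.isingPlus (N ω) β (B ω) ℓ))
            (IsingTree.marginal (U ω) (IsingTree.isingFree (N ω) β (B ω) ℓ))) ∂P
          ≤ (M βmax Bmin Δ : ℝ≥0∞) / ((ℓ - r : ℕ) : ℝ≥0∞) *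
            ∫⁻ ω, (C βmax Bmax : ℝ≥0∞) ^ (IsingTree.ball (N ω) r).card ∂P := by
  refine ⟨fun βmax Bmin _ => (IsingTree.messageRatio βmax Bmin).toNNReal,
    fun βmax Bmax => (8 * Real.exp (2 * (βmax + Bmax))).toNNReal, ?_⟩
  intro Δ Bmin Bmax βmax hmin hle Ω _ P _ N _ r ℓ hrℓ B _ hBmax hBmin U _ hU β hβ hβm
  have hn : (0 : ℝ) < ((ℓ - r : ℕ) : ℝ) := by exact_mod_cast Nat.sub_pos_of_lt hrℓ
  have hK : 0 ≤ IsingTree.messageRatio βmax Bmin :=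
    div_nonneg (hβ.trans hβm) (IsingTree.message_nonneg (hβ.trans hβm) hmin.le)
  rw [← lintegral_const_mul' _ _ (ENNReal.div_ne_top ENNReal.coe_ne_top
    (Nat.cast_ne_zero.2 (Nat.sub_pos_of_lt hrℓ).ne'))]
  refine lintegral_mono_ae ?_
  filter_upwards [hBmax, hBmin, hU] with ω h₁ h₂ h₃
  refine (ENNReal.ofReal_le_ofReal
    (IsingTree.tvDist_plus_free_le hβ hβm hmin hle hrℓ h₁ h₂ h₃)).trans_eq ?_
  rw [ENNReal.ofReal_mul (by positivity), ENNReal.ofReal_div_of_pos hn, ENNReal.ofReal_natCast,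
    ENNReal.ofReal_pow (by positivity)]
  rfl
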